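/- For positive integers $s_1,\dots,s_r$ with $s_1\ge 2$ let $\zeta^\star(s_1,\dots,s_r)=\sum_{k_1\ge\cdots\ge k_r\ge 1}\frac{1}{k_1^{s_1}\cdots k_r^{s_r}}$ be the multiple zeta star value (a convergent series), and let $\{a_1,\dots,a_k\}^d$ denote $d$ successive repetitions of the sequence $a_1,\dots,a_k$. Let $B_n$ be the Bernoulli numbers. For integers $m,N\ge 0$ put $$ S_m(N)=\sum_{\substack{n_0+\cdots+n_m=N\\ n_0,\dots,n_m\ge 0}}\exp\left(\frac{2\pi i}{m+1}\sum_{k=0}^m k n_k\right)\prod_{k=0}^m\left(\sum_{l=0}^{n_k}(4^{l+1}-1)\frac{B_{2l+2}}{(2l+2)!}\,\frac{B_{2n_k-2l}}{(2n_k-2l)!}\,e^{\frac{\pi i l}{m+1}}\right). $$ Then for every integer $d\ge 1$ and every integer $m\ge 0$, $$ \zeta^\star\bigl(\{\{2\}^m,3,\{2\}^m,1\}^d\bigr)=4^{m+1}\pi^{4d(m+1)}\,S_m\bigl(2(m+1)d\bigr) $$ and $$ \zeta^\star\bigl(\{\{2\}^m,3,\{2\}^m,1\}^d,\{2\}^{m+1}\bigr)=(-1)^m4^{m+1}\pi^{(4d+2)(m+1)}\,S_m\bigl((m+1)(2d+1)\bigr).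 $$ Moreover, these two values are rational multiples of $\pi^{4(m+1)d}$ and $\pi^{2(m+1)(2d+1)}$, respectively. -/

import Mathlib

open Finset

/-- The term `1 / (k₁^{s₁} ⋯ k_r^{s_r})` of the series of a multiple zeta (star) value. -/
noncomputable def mzvTerm (s : List ℕ) (k : Fin s.length → ℕ) : ℝ :=
  ∏ i, 1 / (k i : ℝ) ^ s.get i

/-- The summation range `k₁ ≥ ⋯ ≥ k_r ≥ 1` of a multiple zeta star value of depth `r`. -/
def StarIndex (r : ℕ) : Type :=
  {k : Fin r → ℕ // Antitone k ∧ ∀ i, 1 ≤ k i}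

/-- Convergence of the series defining `ζ⋆(s₁, …, s_r)`. All terms are positive, so this is the
same as absolute convergence. -/
def ZetaStarConverges (s : List ℕ) : Prop :=
  Summable fun k : StarIndex s.length => mzvTerm s k.1

/-- The multiple zeta star value `ζ⋆(s₁, …, s_r)`. -/
noncomputable def zetaStar (s : List ℕ) : ℝ :=
  ∑' k : StarIndex s.length, mzvTerm s k.1

/-- The index `{{2}^m, 3, {2}^m, 1}^d`. -/
def index321 (m d : ℕ) : List ℕ :=
  (List.replicate d (List.replicate m 2 ++ [3] ++ List.replicate m 2 ++ [1])).flatten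

/-- The convolution
`∑_{l=0}^{n} (4^{l+1} - 1) B_{2l+2}/(2l+2)! B_{2n-2l}/(2n-2l)! e^{π i l/(m+1)}`. -/
noncomputable def bernoulliConv (m n : ℕ) : ℂ :=
  ∑ l ∈ range (n + 1),
    ((4 : ℂ) ^ (l + 1) - 1) *
      ((bernoulli (2 * l + 2) : ℂ) / ((2 * l + 2).factorial : ℂ)) *
      ((bernoulli (2 * n - 2 * l) : ℂ) / ((2 * n - 2 * l).factorial : ℂ)) *
      Complex.exp (Real.pi * Complex.I * l / (m + 1))

/-- The sum over all `(n_0, …, n_m)` of non-negative integers with `n_0 + ⋯ + n_m = N` of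
`exp (2πi/(m+1) ∑ k n_k) ∏_k bernoulliConv m n_k`. -/
noncomputable def compositionSum (m N : ℕ) : ℂ :=
  ∑ n ∈ piAntidiag (univ : Finset (Fin (m + 1))) N,
    Complex.exp (2 * Real.pi * Complex.I / (m + 1) * ∑ k : Fin (m + 1), ((k : ℕ) : ℂ) * (n k : ℂ)) *
      ∏ k : Fin (m + 1), bernoulliConv m (n k)

/-!
Expand the star sum of `s` truncated at `k₁ ≤ N` as `∑ k, c k * N! ^ 2 / ((N - k)! * (N + k)!)`.
Putting an entry `1`, `2` or `3` in front of `s` changes the coefficients `c` by divisions by powers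
of `k` and by at most one (signed) summation. For the blocks `{2}^m, 3, {2}^m, 1` the resulting
recursion is the one satisfied by the increments in `n` of the coefficients of
`∏_{k ≤ n} (1 + y_k X) / (1 - y_k X)` with `y_k = (-1) ^ k / k ^ (2m+2)`. Letting `N → ∞`, the star
value is the sum of these increments, that is a coefficient of the infinite product.

The logarithmic derivative of the infinite product consists of alternating zeta values, hence of
Bernoulli numbers. It agrees, after rescaling by a power of `π`, with that of
`∏_{k ≤ m} φ (ω ^ (2k) X) / φ (ω ^ (2k+1) X)` read as a series in `X ^ (m+1)`, where
`φ = ∑ B_{2n} / (2n)! X ^ n` and `ω = e^{π i / (m+1)}`. Since a series is determined by its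
constant coefficient and its logarithmic derivative, the two products agree. By the duplication
formula of `coth`, `1 / φ = 4 * ∑ (4 ^ (l+1) - 1) B_{2l+2} / (2l+2)! X ^ l`, so that the
coefficients of the second product are the sums `4 ^ (m+1) S_m`; they are rational because its
logarithmic derivative is.
-/

section TruncatedStar

/-- The truncated star sum `∑_{N ≥ k₁ ≥ ⋯ ≥ k_r ≥ 1} 1 / (k₁^{s₁} ⋯ k_r^{s_r})`, by recursion on the
outermost index `k₁ = n + 1`. -/
noncomputable def truncatedStar : List ℕ → ℕ → ℝ
  | [], _ => 1
  | a :: s, N => ∑ n ∈ range N, 1 / ((n : ℝ) + 1) ^ a * truncatedStar s (n + 1)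

theorem truncatedStar_cons_succ (a : ℕ) (s : List ℕ) (N : ℕ) :
    truncatedStar (a :: s) (N + 1) =
      truncatedStar (a :: s) N + 1 / ((N : ℝ) + 1) ^ a * truncatedStar s (N + 1) := by
  simp only [truncatedStar, sum_range_succ]

open Classical in
/-- The summation range `N ≥ k₁ ≥ ⋯ ≥ k_r ≥ 1` of a truncated star sum of depth `r`. -/
noncomputable def starBox (r N : ℕ) : Finset (Fin r → ℕ) :=
  (Fintype.piFinset fun _ => Icc 1 N).filter Antitone

theorem mem_starBox {r N : ℕ} {k : Fin r → ℕ} :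
    k ∈ starBox r N ↔ (∀ i, 1 ≤ k i ∧ k i ≤ N) ∧ Antitone k := by
  simp [starBox, Fintype.mem_piFinset]

theorem starBox_zero (N : ℕ) : starBox 0 N = {Fin.elim0} := by
  ext k
  rw [mem_starBox, mem_singleton]
  exact ⟨fun _ => Subsingleton.elim _ _, fun _ => ⟨fun i => i.elim0, fun i => i.elim0⟩⟩

theorem antitone_fin_cons {α : Type*} [Preorder α] {r : ℕ} {a : α} {k : Fin r → α} :
    Antitone (Fin.cons a k : Fin (r + 1) → α) ↔ (∀ i, k i ≤ a) ∧ Antitone k := by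
  constructor
  · intro h
    refine ⟨fun i => by simpa using h (Fin.zero_le i.succ), fun i j hij => ?_⟩
    simpa using h (Fin.succ_le_succ_iff.2 hij)
  · rintro ⟨hle, hk⟩ i j
    cases i using Fin.cases <;> cases j using Fin.cases
    · simp
    · simpa using hle _
    · simp
    · simpa using @hk _ _

theorem cons_mem_starBox {r N n : ℕ} {k : Fin r → ℕ} :
    (Fin.cons n k : Fin (r + 1) → ℕ) ∈ starBox (r + 1) N ↔
      (1 ≤ n ∧ n ≤ N) ∧ k ∈ starBox r n := by
  simp only [mem_starBox, antitone_fin_cons, Fin.forall_fin_succ, Fin.cons_zero, Fin.cons_succ]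
  constructor
  · rintro ⟨⟨hn, hk⟩, hle, hanti⟩
    exact ⟨hn, fun i => ⟨(hk i).1, hle i⟩, hanti⟩
  · rintro ⟨hn, hk, hanti⟩
    exact ⟨⟨hn, fun i => ⟨(hk i).1, (hk i).2.trans hn.2⟩⟩, fun i => (hk i).2, hanti⟩

theorem sum_starBox_succ {M : Type*} [AddCommMonoid M] (r N : ℕ) (g : (Fin (r + 1) → ℕ) → M) :
    ∑ k ∈ starBox (r + 1) N, g k =
      ∑ n ∈ range N, ∑ k ∈ starBox r (n + 1), g (Fin.cons (n + 1) k) := by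
  have cons_tail {k : Fin (r + 1) → ℕ} (hk : k ∈ starBox (r + 1) N) :
      (Fin.cons (k 0 - 1 + 1) (Fin.tail k) : Fin (r + 1) → ℕ) = k := by
    rw [Nat.sub_add_cancel ((mem_starBox.1 hk).1 0).1, Fin.cons_self_tail]
  rw [Finset.sum_sigma']
  refine Finset.sum_nbij' (fun k => ⟨k 0 - 1, Fin.tail k⟩)
    (fun p => (Fin.cons (p.1 + 1) p.2 : Fin (r + 1) → ℕ)) (fun k hk => ?_) (fun p hp => ?_)
    (fun k hk => cons_tail hk) (fun p _ => by simp) (fun k hk => by rw [cons_tail hk])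
  · rw [← cons_tail hk, cons_mem_starBox] at hk
    exact mem_sigma.2 ⟨mem_range.2 hk.1.2, hk.2⟩
  · rw [mem_sigma, mem_range] at hp
    exact cons_mem_starBox.2 ⟨⟨Nat.le_add_left 1 p.1, hp.1⟩, hp.2⟩

theorem mzvTerm_cons (a : ℕ) (s : List ℕ) (n : ℕ) (k : Fin s.length → ℕ) :
    mzvTerm (a :: s) (Fin.cons n k : Fin (s.length + 1) → ℕ) = 1 / (n : ℝ) ^ a * mzvTerm s k :=
  Fin.prod_univ_succ _

theorem mzvTerm_nonneg (s : List ℕ) (k : Fin s.length → ℕ) : 0 ≤ mzvTerm s k :=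
  prod_nonneg fun i _ => by positivity

theorem sum_starBox_mzvTerm (s : List ℕ) (N : ℕ) :
    ∑ k ∈ starBox s.length N, mzvTerm s k = truncatedStar s N := by
  induction s generalizing N with
  | nil =>
    exact (congrArg (Finset.sum · _) (starBox_zero N)).trans (by simp [truncatedStar, mzvTerm])
  | cons a s ih =>
    refine (sum_starBox_succ s.length N _).trans (sum_congr rfl fun n _ => ?_)
    rw [← ih, mul_sum]
    exact sum_congr rfl fun k _ => by rw [mzvTerm_cons, Nat.cast_succ]

open Filter Topology in
theorem hasSum_of_tendsto_sum_of_nonneg {ι κ : Type*} {f : ι → ℝ} (hf : ∀ i, 0 ≤ f i) {l : Filter κ}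
    [l.NeBot] {s : κ → Finset ι} (hs : Tendsto s l atTop) {L : ℝ}
    (h : Tendsto (fun n => ∑ i ∈ s n, f i) l (𝓝 L)) : HasSum f L := by
  have hsummable : Summable f := summable_of_sum_le hf fun u =>
    ge_of_tendsto h <| (hs.eventually_ge_atTop u).mono fun n hn =>
      sum_le_sum_of_subset_of_nonneg hn fun i _ _ => hf i
  exact tendsto_nhds_unique (hsummable.hasSum.comp hs) h ▸ hsummable.hasSum

open Filter Topology in
theorem hasSum_mzvTerm_of_tendsto {s : List ℕ} {L : ℝ} (h : Tendsto (truncatedStar s) atTop (𝓝 L)) :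
    HasSum (fun k : StarIndex s.length => mzvTerm s k.1) L := by
  classical
  let box (N : ℕ) : Finset (StarIndex s.length) :=
    (starBox s.length N).subtype fun k => Antitone k ∧ ∀ i, 1 ≤ k i
  have mem_box (N : ℕ) (k : StarIndex s.length) : k ∈ box N ↔ ∀ i, k.1 i ≤ N := by
    refine mem_subtype.trans (mem_starBox.trans ?_)
    exact ⟨fun h i => (h.1 i).2, fun h => ⟨fun i => ⟨k.2.2 i, h i⟩, k.2.1⟩⟩
  have sum_box (N : ℕ) : ∑ k ∈ box N, mzvTerm s k.1 = truncatedStar s N := by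
    rw [← sum_starBox_mzvTerm]
    exact sum_subtype_of_mem (fun k => mzvTerm s k)
      fun k hk => ⟨(mem_starBox.1 hk).2, fun i => ((mem_starBox.1 hk).1 i).1⟩
  have tendsto_box : Tendsto box atTop atTop := by
    refine tendsto_atTop_finset_of_monotone (fun M N hMN k hk => ?_) fun k => ⟨∑ i, k.1 i, ?_⟩
    · exact (mem_box N k).2 fun i => ((mem_box M k).1 hk i).trans hMN
    · exact (mem_box _ k).2 fun i => single_le_sum (fun _ _ => Nat.zero_le _) (mem_univ i)
  have nonneg (k : StarIndex s.length) : 0 ≤ mzvTerm s k.1 := mzvTerm_nonneg s k.1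
  refine hasSum_of_tendsto_sum_of_nonneg nonneg tendsto_box ?_
  simpa only [sum_box] using h

end TruncatedStar

section DoubledSum

variable {R : Type*} [CommRing R]

/-- The sum `x_j + 2 ∑_{k < j} x_k`, the operation by which multiplication by `N` acts on
expansions in `starKernel`. -/
def doubledSum (x : ℕ → R) (j : ℕ) : R := x j + 2 * ∑ k ∈ range j, x k

theorem doubledSum_succ (x : ℕ → R) (j : ℕ) :
    doubledSum x (j + 1) = doubledSum x j + x (j + 1) + x j := by
  simp only [doubledSum, sum_range_succ]
  ring

theorem doubledSum_neg (x : ℕ → R) (j : ℕ) : doubledSum (fun k => -x k) j = -doubledSum x j := by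
  simp only [doubledSum, sum_neg_distrib]
  ring

theorem doubledSum_alternating (j : ℕ) : doubledSum (fun k => (2 : R) * (-1) ^ k) j = 2 := by
  induction j with
  | zero => simp [doubledSum]
  | succ j ih => rw [doubledSum_succ, ih]; ring

theorem doubledSum_sign_doubledSum_sign (x : ℕ → R) (j : ℕ) :
    doubledSum (fun k => (-1) ^ k * doubledSum (fun i => (-1) ^ i * x i) k) j = x j := by
  induction j with
  | zero => simp [doubledSum]
  | succ j ih =>
    rw [doubledSum_succ, ih, doubledSum_succ]
    have hsign : ((-1 : R) ^ j) ^ 2 = 1 := by rw [pow_right_comm, neg_one_sq, one_pow]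
    rw [pow_succ]
    linear_combination (x (j + 1) - x j) * hsign

end DoubledSum

section StarKernel

/-- The kernel `N!² / ((N - k)! (N + k)!)`, in terms of which truncated star sums are expanded. It
is written as a product so that it vanishes for `k > N`. -/
noncomputable def starKernel (N k : ℕ) : ℝ :=
  ∏ i ∈ range k, ((N : ℝ) - i) / (N + 1 + i)

theorem starKernel_zero (N : ℕ) : starKernel N 0 = 1 := by simp [starKernel]

theorem starKernel_succ (N k : ℕ) :
    ((N : ℝ) + k + 1) * starKernel N (k + 1) = (N - k) * starKernel N k := by
  have : (N : ℝ) + 1 + k ≠ 0 := by positivity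
  rw [starKernel, prod_range_succ, ← starKernel]
  field_simp
  ring

theorem starKernel_of_lt {N k : ℕ} (h : N < k) : starKernel N k = 0 :=
  prod_eq_zero (mem_range.2 h) (by simp)

theorem starKernel_mem_Icc (N k : ℕ) : starKernel N k ∈ Set.Icc 0 1 := by
  rcases lt_or_ge N k with h | h
  · simp [starKernel_of_lt h]
  have numerator_nonneg (i : ℕ) (hi : i ∈ range k) : 0 ≤ (N : ℝ) - i :=
    sub_nonneg.2 (by exact_mod_cast (mem_range.1 hi).le.trans h)
  have factor_nonneg (i : ℕ) (hi : i ∈ range k) : 0 ≤ ((N : ℝ) - i) / (N + 1 + i) :=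
    div_nonneg (numerator_nonneg i hi) (by positivity)
  refine ⟨prod_nonneg factor_nonneg, prod_le_one factor_nonneg fun i _ => ?_⟩
  rw [div_le_one (by positivity)]
  linarith [(Nat.cast_nonneg i : (0 : ℝ) ≤ i)]

theorem starKernel_succ_left (N k : ℕ) :
    ((N : ℝ) + 1) ^ 2 * starKernel N k =
      ((N : ℝ) + 1 - k) * (N + 1 + k) * starKernel (N + 1) k := by
  induction k with
  | zero => simp [starKernel_zero]; ring
  | succ k ih =>
    have hN := starKernel_succ N k
    have hN1 := starKernel_succ (N + 1) k
    have h0 : (N : ℝ) + k + 1 ≠ 0 := by positivity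
    push_cast at hN1 ⊢
    apply mul_left_cancel₀ h0
    linear_combination ((N : ℝ) + 1) ^ 2 * hN + (N - k) * ih - (N - k) * (N + k + 1) * hN1

open Filter Topology in
theorem tendsto_starKernel (k : ℕ) : Tendsto (starKernel · k) atTop (𝓝 1) := by
  have hfactor (i : ℕ) : Tendsto (fun N : ℕ => ((N : ℝ) - i) / (N + 1 + i)) atTop (𝓝 1) := by
    have h : Tendsto (fun N : ℕ => 1 - (2 * (i : ℝ) + 1) / ((N : ℝ) + (1 + i))) atTop
        (𝓝 (1 - 0)) :=
      tendsto_const_nhds.sub ((tendsto_atTop_add_const_right _ _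
        tendsto_natCast_atTop_atTop).const_div_atTop _)
    rw [sub_zero] at h
    refine h.congr fun N => ?_
    have : (N : ℝ) + 1 + i ≠ 0 := by positivity
    field_simp
    ring
  simpa [starKernel] using tendsto_finsetProd (range k) fun i _ => hfactor i

/-- The sum `∑_{k=1}^N c_k N!² / ((N - k)! (N + k)!)` with `c_k` stored at the index `k - 1`; star
sums are described by their coefficients `c` in this expansion. -/
noncomputable def kernelSum (c : ℕ → ℝ) (N : ℕ) : ℝ := ∑ k ∈ range N, c k * starKernel N (k + 1)

theorem kernelSum_succ_sub (c : ℕ → ℝ) (N : ℕ) :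
    ((N : ℝ) + 1) ^ 2 * (kernelSum c (N + 1) - kernelSum c N) =
      kernelSum (fun k => ((k : ℝ) + 1) ^ 2 * c k) (N + 1) := by
  have hlast : kernelSum c N = ∑ k ∈ range (N + 1), c k * starKernel N (k + 1) := by
    rw [sum_range_succ, starKernel_of_lt N.lt_succ_self, mul_zero, add_zero, kernelSum]
  rw [hlast, kernelSum, kernelSum, ← sum_sub_distrib, mul_sum]
  refine sum_congr rfl fun k _ => ?_
  have h := starKernel_succ_left N (k + 1)
  push_cast at h
  linear_combination (-c k) * h

theorem mul_sum_starKernel (c : ℕ → ℝ) (N M : ℕ) :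
    N * ∑ k ∈ range M, c k * starKernel N (k + 1) =
      ∑ k ∈ range M, ((k : ℝ) + 1) * doubledSum c k * starKernel N (k + 1) +
        (∑ k ∈ range M, c k) * ((N - M) * starKernel N M) := by
  induction M with
  | zero => simp
  | succ M ih =>
    simp only [sum_range_succ, mul_add, ih, doubledSum]
    push_cast
    linear_combination (-∑ k ∈ range M, c k) * starKernel_succ N M

theorem mul_kernelSum (c : ℕ → ℝ) (N : ℕ) :
    N * kernelSum c N = kernelSum (fun k => ((k : ℝ) + 1) * doubledSum c k) N := by
  simpa [kernelSum] using mul_sum_starKernel c N N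

theorem sum_mul_starKernel (N M : ℕ) :
    ∑ k ∈ range M, ((k : ℝ) + 1) * 2 * starKernel N (k + 1) = N - (N - M) * starKernel N M := by
  induction M with
  | zero => simp [starKernel_zero]
  | succ M ih =>
    rw [sum_range_succ, ih]
    push_cast
    linear_combination starKernel_succ N M

theorem kernelSum_alternating (N : ℕ) : kernelSum (fun k => 2 * (-1) ^ k) (N + 1) = 1 := by
  have h := mul_kernelSum (fun k => 2 * (-1) ^ k) (N + 1)
  simp only [doubledSum_alternating, kernelSum, sum_mul_starKernel, sub_self, zero_mul,
    sub_zero] at h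
  exact mul_left_cancel₀ (Nat.cast_ne_zero.2 N.succ_ne_zero) (h.trans (mul_one _).symm)

open Filter Topology in
theorem tendsto_kernelSum {c : ℕ → ℝ} (hc : Summable fun k => |c k|) :
    Tendsto (kernelSum c) atTop (𝓝 (∑' k, c k)) := by
  have htsum (N : ℕ) : ∑' k, c k * starKernel N (k + 1) = kernelSum c N :=
    tsum_eq_sum fun k hk => by rw [starKernel_of_lt (by simpa using hk), mul_zero]
  refine Tendsto.congr htsum (tendsto_tsum_of_dominated_convergence hc (fun k => ?_)
    (.of_forall fun N k => ?_))
  · simpa using (tendsto_starKernel (k + 1)).const_mul (c k)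
  · obtain ⟨h0, h1⟩ := starKernel_mem_Icc N (k + 1)
    rw [norm_mul, Real.norm_eq_abs, Real.norm_of_nonneg h0]
    exact mul_le_of_le_one_right (abs_nonneg _) h1

end StarKernel

section HasStarCoeff

/-- `HasStarCoeff s c` says that `c` is the coefficient sequence of the truncated star sums of `s`
in terms of `starKernel`. The truncation at `0` is left out: there the expansion is empty, whereas
the star sum of the empty index is `1`. -/
def HasStarCoeff (s : List ℕ) (c : ℕ → ℝ) : Prop :=
  ∀ N, truncatedStar s (N + 1) = kernelSum c (N + 1)

namespace HasStarCoeff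

variable {s : List ℕ} {c : ℕ → ℝ}

theorem nil : HasStarCoeff [] fun k => 2 * (-1) ^ k := fun N => (kernelSum_alternating N).symm

theorem cons (hc : HasStarCoeff s c) {c' : ℕ → ℝ} {a : ℕ}
    (h : ∀ N : ℕ, ((N : ℝ) + 1) ^ a * kernelSum (fun k => ((k : ℝ) + 1) ^ 2 * c' k) (N + 1) =
      ((N : ℝ) + 1) ^ 2 * kernelSum c (N + 1)) :
    HasStarCoeff (a :: s) c' := by
  have key (N : ℕ) : truncatedStar (a :: s) N = kernelSum c' N := by
    induction N with
    | zero => simp [truncatedStar, kernelSum]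
    | succ N ih =>
      have h0 : (N : ℝ) + 1 ≠ 0 := by positivity
      have hincr : ((N : ℝ) + 1) ^ a * (kernelSum c' (N + 1) - kernelSum c' N) =
          kernelSum c (N + 1) := by
        apply mul_left_cancel₀ (pow_ne_zero 2 h0)
        rw [← h N, ← kernelSum_succ_sub]
        ring
      rw [truncatedStar_cons_succ, ih, hc N, ← hincr]
      field_simp
      ring
  exact fun N => key (N + 1)

theorem cons_two (hc : HasStarCoeff s c) :
    HasStarCoeff (2 :: s) fun k => c k / ((k : ℝ) + 1) ^ 2 := by
  refine hc.cons fun N => ?_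
  congr 2
  ext k
  have : (k : ℝ) + 1 ≠ 0 := by positivity
  field_simp

theorem cons_one (hc : HasStarCoeff s c) :
    HasStarCoeff (1 :: s) fun k => doubledSum c k / ((k : ℝ) + 1) := by
  refine hc.cons fun N => ?_
  have h := mul_kernelSum c (N + 1)
  push_cast at h
  rw [pow_one, sq ((N : ℝ) + 1), mul_assoc, h]
  congr 2
  ext k
  have : (k : ℝ) + 1 ≠ 0 := by positivity
  field_simp

theorem cons_three (hc : HasStarCoeff s c) :
    HasStarCoeff (3 :: s) fun k =>
      (-1) ^ k * doubledSum (fun i => (-1) ^ i * (c i / ((i : ℝ) + 1))) k / ((k : ℝ) + 1) ^ 2 := by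
  refine hc.cons fun N => ?_
  set e : ℕ → ℝ := fun k => (-1) ^ k * doubledSum (fun i => (-1) ^ i * (c i / ((i : ℝ) + 1))) k
  have h := mul_kernelSum e (N + 1)
  simp only [e, doubledSum_sign_doubledSum_sign] at h
  push_cast at h
  have hl : (fun k : ℕ => ((k : ℝ) + 1) ^ 2 * (e k / ((k : ℝ) + 1) ^ 2)) = e := by
    ext k
    exact mul_div_cancel₀ _ (by positivity)
  have hr : (fun k : ℕ => ((k : ℝ) + 1) * (c k / ((k : ℝ) + 1))) = c := by
    ext k
    exact mul_div_cancel₀ _ (by positivity)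
  rw [hl, pow_succ, mul_assoc, h, hr]

theorem replicate_two (hc : HasStarCoeff s c) (m : ℕ) :
    HasStarCoeff (List.replicate m 2 ++ s) fun k => c k / ((k : ℝ) + 1) ^ (2 * m) := by
  induction m with
  | zero => simpa using hc
  | succ m ih =>
    rw [List.replicate_succ, List.cons_append]
    convert ih.cons_two using 2 with k
    rw [div_div, ← pow_add, Nat.mul_succ]

open Filter Topology in
theorem hasSum_mzvTerm (hc : HasStarCoeff s c) (hs : Summable fun k => |c k|) :
    HasSum (fun k : StarIndex s.length => mzvTerm s k.1) (∑' k, c k) := by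
  refine hasSum_mzvTerm_of_tendsto ((tendsto_kernelSum hs).congr' ?_)
  filter_upwards [eventually_ge_atTop 1] with N hN
  obtain ⟨N, rfl⟩ := Nat.exists_eq_add_of_le' hN
  exact (hc N).symm

end HasStarCoeff

/-- The sequence `(-1) ^ n / n ^ (2m + 2)` with `n = k + 1`. These are the parameters of the product
of Cayley series attached to the blocks `{2}^m, 3, {2}^m, 1`. -/
noncomputable def altPow (m k : ℕ) : ℝ := (-1) ^ (k + 1) / ((k : ℝ) + 1) ^ (2 * m + 2)

theorem HasStarCoeff.block {s : List ℕ} {c : ℕ → ℝ} (hc : HasStarCoeff s c) (a b : ℕ) :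
    HasStarCoeff (List.replicate a 2 ++ [3] ++ List.replicate b 2 ++ [1] ++ s)
      fun k => altPow a k * doubledSum (fun i => altPow b i * doubledSum c i) k := by
  have h := ((hc.cons_one.replicate_two b).cons_three).replicate_two a
  have hinner : (fun i : ℕ => (-1 : ℝ) ^ i *
      (doubledSum c i / ((i : ℝ) + 1) / ((i : ℝ) + 1) ^ (2 * b) / ((i : ℝ) + 1))) =
      fun i => -(altPow b i * doubledSum c i) := by
    ext i
    rw [altPow]
    field_simp
    ring
  simp only [hinner, doubledSum_neg] at h
  simp only [List.append_assoc, List.cons_append, List.nil_append]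
  convert h using 2 with k
  rw [altPow]
  field_simp
  ring

theorem summable_abs_altPow (m : ℕ) : Summable fun k => |altPow m k| := by
  have h := (hasSum_zeta_nat m.succ_ne_zero).summable.comp_injective Nat.succ_injective
  refine h.congr fun k => ?_
  have : (0 : ℝ) < ((k : ℝ) + 1) ^ (2 * m + 2) := by positivity
  simp [altPow, abs_div, abs_of_pos this, mul_add]

end HasStarCoeff

section LogDeriv

open PowerSeries

variable {R : Type*} [CommRing R]

variable (R) in
/-- The Euler operator `X d/dX` on power series, which acts on coefficients by `n` and hence, unlike
`d/dX`, commutes with rescaling. -/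
noncomputable def eulerDeriv : Derivation R R⟦X⟧ R⟦X⟧ :=
  (X : R⟦X⟧) • derivative R

theorem eulerDeriv_apply (f : R⟦X⟧) : eulerDeriv R f = X * derivative R f := rfl

theorem coeff_eulerDeriv (f : R⟦X⟧) (n : ℕ) : coeff n (eulerDeriv R f) = n * coeff n f := by
  rw [eulerDeriv_apply]
  cases n with
  | zero => simp
  | succ n => rw [coeff_succ_X_mul, coeff_derivative, mul_comm, Nat.cast_succ]

theorem constantCoeff_rescale (a : R) (f : R⟦X⟧) :
    constantCoeff (rescale a f) = constantCoeff f := by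
  simp [← coeff_zero_eq_constantCoeff]

theorem eulerDeriv_rescale (a : R) (f : R⟦X⟧) :
    eulerDeriv R (rescale a f) = rescale a (eulerDeriv R f) := by
  ext n
  simp only [coeff_eulerDeriv, coeff_rescale]
  ring

theorem eulerDeriv_map {S : Type*} [CommRing S] (φ : R →+* S) (f : R⟦X⟧) :
    eulerDeriv S (map φ f) = map φ (eulerDeriv R f) := by
  ext n
  simp [coeff_eulerDeriv]

theorem eulerDeriv_expand (p : ℕ) (hp : p ≠ 0) (f : R⟦X⟧) :
    eulerDeriv R (expand p hp f) = p * expand p hp (eulerDeriv R f) := by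
  ext n
  rw [coeff_eulerDeriv, ← map_natCast (C (R := R)) p, coeff_C_mul]
  rcases em (p ∣ n) with ⟨k, rfl⟩ | h
  · simp only [coeff_expand_mul, coeff_eulerDeriv, Nat.cast_mul, mul_assoc]
  · simp only [coeff_expand_of_not_dvd p hp _ h, mul_zero]

/-- `HasLogDeriv f b` says that `b` is the logarithmic derivative of `f`, taken with respect to the
Euler operator `X d/dX`. It is stated without division, so that it makes sense over any ring. -/
def HasLogDeriv (f b : R⟦X⟧) : Prop := eulerDeriv R f = f * b

namespace HasLogDeriv

theorem mul {f g b c : R⟦X⟧} (hf : HasLogDeriv f b) (hg : HasLogDeriv g c) :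
    HasLogDeriv (f * g) (b + c) := by
  unfold HasLogDeriv at *
  rw [Derivation.leibniz, hf, hg, smul_eq_mul, smul_eq_mul]
  ring

theorem prod {ι : Type*} (s : Finset ι) {f b : ι → R⟦X⟧} (h : ∀ i ∈ s, HasLogDeriv (f i) (b i)) :
    HasLogDeriv (∏ i ∈ s, f i) (∑ i ∈ s, b i) := by
  classical
  induction s using Finset.induction_on with
  | empty => simp [HasLogDeriv]
  | insert i s hi ih =>
    rw [prod_insert hi, sum_insert hi]
    exact (h i (mem_insert_self i s)).mul (ih fun j hj => h j (mem_insert_of_mem hj))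

theorem of_mul_eq_one {f g b : R⟦X⟧} (hf : HasLogDeriv f b) (h : f * g = 1) :
    HasLogDeriv g (-b) := by
  unfold HasLogDeriv at *
  have := congrArg (eulerDeriv R) h
  rw [Derivation.leibniz, hf, Derivation.map_one_eq_zero, smul_eq_mul, smul_eq_mul] at this
  linear_combination g * this - (eulerDeriv R g + g * b) * h

theorem rescale {f b : R⟦X⟧} (hf : HasLogDeriv f b) (a : R) :
    HasLogDeriv (rescale a f) (PowerSeries.rescale a b) := by
  rw [HasLogDeriv, eulerDeriv_rescale, hf, map_mul]

theorem map {S : Type*} [CommRing S] {f b : R⟦X⟧} (hf : HasLogDeriv f b) (φ : R →+* S) :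
    HasLogDeriv (map φ f) (PowerSeries.map φ b) := by
  rw [HasLogDeriv, eulerDeriv_map, hf, map_mul]

theorem expand {f b : R⟦X⟧} (hf : HasLogDeriv f b) (p : ℕ) (hp : p ≠ 0) :
    HasLogDeriv (expand p hp f) (p * PowerSeries.expand p hp b) := by
  rw [HasLogDeriv, eulerDeriv_expand, hf, map_mul]
  ring

theorem constantCoeff_eq_zero {f b : R⟦X⟧} (hf : HasLogDeriv f b) (h0 : constantCoeff f = 1) :
    constantCoeff b = 0 := by
  have := congrArg constantCoeff hf
  rwa [eulerDeriv_apply, map_mul, map_mul, constantCoeff_X, zero_mul, h0, one_mul, eq_comm] at this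

theorem succ_mul_coeff {f b : R⟦X⟧} (hf : HasLogDeriv f b) (h0 : constantCoeff f = 1) (n : ℕ) :
    (n + 1) * coeff (n + 1) f = ∑ p ∈ antidiagonal n, coeff p.1 f * coeff (p.2 + 1) b := by
  have := congrArg (coeff (n + 1)) hf
  rwa [coeff_eulerDeriv, coeff_mul, Finset.Nat.sum_antidiagonal_succ', Nat.cast_succ,
    coeff_zero_eq_constantCoeff_apply b, hf.constantCoeff_eq_zero h0, mul_zero, zero_add] at this

theorem unique [IsDomain R] [CharZero R] {f g b : R⟦X⟧} (hf : HasLogDeriv f b)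
    (hg : HasLogDeriv g b) (hf0 : constantCoeff f = 1) (hg0 : constantCoeff g = 1) : f = g := by
  ext r
  induction r using Nat.strong_induction_on with
  | _ r ih =>
    cases r with
    | zero => simp only [coeff_zero_eq_constantCoeff, hf0, hg0]
    | succ n =>
      apply mul_left_cancel₀ (Nat.cast_add_one_ne_zero (R := R) n)
      rw [hf.succ_mul_coeff hf0, hg.succ_mul_coeff hg0]
      refine sum_congr rfl fun p hp => ?_
      rw [ih p.1 (Nat.lt_succ_of_le (HasAntidiagonal.antidiagonal.fst_le hp))]

open Filter Topology in
theorem tendsto_coeff {K ι : Type*} [Field K] [CharZero K] [TopologicalSpace K]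
    [IsTopologicalRing K] {l : Filter ι} {f b : ι → K⟦X⟧} {F B : K⟦X⟧}
    (hf : ∀ i, HasLogDeriv (f i) (b i)) (hF : HasLogDeriv F B)
    (hf0 : ∀ i, constantCoeff (f i) = 1) (hF0 : constantCoeff F = 1)
    (hb : ∀ j, Tendsto (fun i => coeff j (b i)) l (𝓝 (coeff j B))) (r : ℕ) :
    Tendsto (fun i => coeff r (f i)) l (𝓝 (coeff r F)) := by
  induction r using Nat.strong_induction_on with
  | _ r ih =>
    cases r with
    | zero => simpa only [coeff_zero_eq_constantCoeff, hf0, hF0] using tendsto_const_nhds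
    | succ n =>
      have coeff_eq {g c : K⟦X⟧} (hg : HasLogDeriv g c) (hg0 : constantCoeff g = 1) :
          coeff (n + 1) g =
            (n + 1 : K)⁻¹ * ∑ p ∈ antidiagonal n, coeff p.1 g * coeff (p.2 + 1) c := by
        rw [← hg.succ_mul_coeff hg0, inv_mul_cancel_left₀ (Nat.cast_add_one_ne_zero n)]
      simp only [coeff_eq hF hF0, coeff_eq (hf _) (hf0 _)]
      refine (tendsto_finsetSum _ fun p hp => ?_).const_mul _
      exact (ih p.1 (Nat.lt_succ_of_le (HasAntidiagonal.antidiagonal.fst_le hp))).mul (hb _)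

end HasLogDeriv

/-- The power series with constant coefficient `1` and logarithmic derivative `b`, obtained as the
exponential of `∑ b_j / j X ^ j`. The constant coefficient of `b`, which has to vanish, is
ignored because `0⁻¹ = 0`. -/
noncomputable def ofLogDeriv {A : Type*} [CommRing A] [Algebra ℚ A] (b : A⟦X⟧) : A⟦X⟧ :=
  (exp A).subst (mk fun j => (j : ℚ)⁻¹ • coeff j b)

section ofLogDeriv

variable {A : Type*} [CommRing A] [Algebra ℚ A]

theorem constantCoeff_ofLogDeriv (b : A⟦X⟧) : constantCoeff (ofLogDeriv b) = 1 := by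
  set u : A⟦X⟧ := mk fun j => (j : ℚ)⁻¹ • coeff j b with hu
  have hu0 : constantCoeff u = 0 := by simp [hu]
  have h : constantCoeff ((exp A - 1).subst u) = 0 :=
    constantCoeff_subst_eq_zero hu0 _ (by simp)
  have hu' := HasSubst.of_constantCoeff_zero' hu0
  rwa [subst_sub hu', ← coe_substAlgHom hu', map_one, map_sub, map_one, sub_eq_zero,
    coe_substAlgHom hu'] at h

theorem hasLogDeriv_ofLogDeriv {b : A⟦X⟧} (hb : constantCoeff b = 0) :
    HasLogDeriv (ofLogDeriv b) b := by
  set u : A⟦X⟧ := mk fun j => (j : ℚ)⁻¹ • coeff j b with hu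
  have hu0 : constantCoeff u = 0 := by simp [hu]
  have hub : X * derivative A u = b := by
    ext j
    rw [← eulerDeriv_apply, coeff_eulerDeriv, coeff_mk]
    rcases eq_or_ne j 0 with rfl | hj
    · simp [hb]
    · rw [← nsmul_eq_mul, ← Nat.cast_smul_eq_nsmul ℚ, smul_smul, mul_inv_cancel₀ (by simpa),
        one_smul]
  have hexp : derivative A (ofLogDeriv b) = ofLogDeriv b * derivative A u := by
    rw [ofLogDeriv, derivative_subst (HasSubst.of_constantCoeff_zero' hu0), derivative_exp]
  rw [HasLogDeriv, eulerDeriv_apply, hexp, mul_left_comm, hub]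

end ofLogDeriv

section Multisection

theorem expand_rescale (p : ℕ) (hp : p ≠ 0) (a : R) (f : R⟦X⟧) :
    expand p hp (rescale (a ^ p) f) = rescale a (expand p hp f) := by
  ext n
  rw [coeff_rescale]
  rcases em (p ∣ n) with ⟨k, rfl⟩ | h
  · simp only [coeff_expand_mul, coeff_rescale, pow_mul]
  · simp only [coeff_expand_of_not_dvd p hp _ h, mul_zero]

theorem expand_injective (p : ℕ) (hp : p ≠ 0) : Function.Injective (expand (R := R) p hp) := by
  intro f g h
  ext n
  rw [← coeff_expand_mul p hp f n, h, coeff_expand_mul]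

theorem sum_primitiveRoot_pow_pow [IsDomain R] {ζ : R} {n : ℕ} (hζ : IsPrimitiveRoot ζ n)
    (j : ℕ) : ∑ k ∈ range n, (ζ ^ k) ^ j = if n ∣ j then (n : R) else 0 := by
  simp only [fun k => pow_right_comm ζ k j]
  split_ifs with h
  · simp [(hζ.pow_eq_one_iff_dvd j).2 h]
  · have hne : ζ ^ j - 1 ≠ 0 := sub_ne_zero.2 fun h' => h ((hζ.pow_eq_one_iff_dvd j).1 h')
    apply mul_left_cancel₀ hne
    rw [mul_geom_sum, pow_right_comm, hζ.pow_eq_one, one_pow, sub_self, mul_zero]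

/-- The multisection `∑ f_{nj} X ^ j` of `f = ∑ f_j X ^ j`. It is the logarithmic derivative of the
product of the rescalings of a series by the `n`-th roots of unity, up to `expand`. -/
noncomputable def multisection (n : ℕ) (f : R⟦X⟧) : R⟦X⟧ := mk fun j => coeff (n * j) f

theorem sum_rescale_primitiveRoot [IsDomain R] {ζ : R} {n : ℕ} (hn : n ≠ 0)
    (hζ : IsPrimitiveRoot ζ n) (f : R⟦X⟧) :
    ∑ k ∈ range n, rescale (ζ ^ k) f = n * expand n hn (multisection n f) := by
  ext j
  rw [map_sum, ← map_natCast (C (R := R)) n, coeff_C_mul]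
  simp only [coeff_rescale, ← sum_mul, sum_primitiveRoot_pow_pow hζ]
  split_ifs with h
  · obtain ⟨i, rfl⟩ := h
    rw [coeff_expand_mul, multisection, coeff_mk]
  · rw [coeff_expand_of_not_dvd n hn _ h, zero_mul, mul_zero]

theorem prod_rescale_primitiveRoot [IsDomain R] [CharZero R] {ζ : R} {n : ℕ}
    (hn : n ≠ 0) (hζ : IsPrimitiveRoot ζ n) {f b F : R⟦X⟧} (hf : HasLogDeriv f b)
    (hF : HasLogDeriv F (multisection n b)) (hf0 : constantCoeff f = 1)
    (hF0 : constantCoeff F = 1) : ∏ k ∈ range n, rescale (ζ ^ k) f = expand n hn F := by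
  have h := HasLogDeriv.prod (range n) fun k _ => hf.rescale (ζ ^ k)
  rw [sum_rescale_primitiveRoot hn hζ] at h
  refine h.unique (hF.expand n hn) ?_ (by rwa [constantCoeff_expand])
  rw [map_prod]
  exact prod_eq_one fun k _ => by rwa [constantCoeff_rescale]

end Multisection

end LogDeriv

section Cayley

open PowerSeries

section CommRing

variable {R : Type*} [CommRing R]

theorem mk_pow_mul_one_sub (y : R) : (PowerSeries.mk fun j => y ^ j) * (1 - C y * X) = 1 := by
  have h := congrArg (rescale y) (mk_one_mul_one_sub_eq_one R)
  simpa [rescale_X, rescale_mk] using h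

theorem hasLogDeriv_one_sub (y : R) :
    HasLogDeriv (1 - C y * X) (1 - PowerSeries.mk fun j => y ^ j) := by
  rw [HasLogDeriv, mul_sub, mul_comm _ (PowerSeries.mk _), mk_pow_mul_one_sub, eulerDeriv_apply]
  simp
  ring

/-- The power series `(1 + y X) / (1 - y X)`, with the inverse of the denominator written out as a
geometric series. -/
noncomputable def cayley (y : R) : R⟦X⟧ := (1 + C y * X) * PowerSeries.mk fun j => y ^ j

theorem cayley_mul_one_sub (y : R) : cayley y * (1 - C y * X) = 1 + C y * X := by
  rw [cayley, mul_assoc, mk_pow_mul_one_sub, mul_one]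

theorem constantCoeff_cayley (y : R) : constantCoeff (cayley y) = 1 := by
  simpa using congrArg constantCoeff (cayley_mul_one_sub y)

theorem hasLogDeriv_cayley (y : R) :
    HasLogDeriv (cayley y) (PowerSeries.mk fun j => y ^ j - (-y) ^ j) := by
  have hnum := hasLogDeriv_one_sub (-y)
  have hden := (hasLogDeriv_one_sub y).of_mul_eq_one
    ((mul_comm _ _).trans (mk_pow_mul_one_sub y))
  rw [map_neg, neg_mul, sub_neg_eq_add] at hnum
  rw [cayley]
  convert hnum.mul hden using 1
  ext j
  simp

/-- The coefficient of `X ^ r` in `∏_{k < n} (1 + y_k X) / (1 - y_k X)`. -/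
noncomputable def cayleyCoeff (y : ℕ → R) (r n : ℕ) : R := coeff r (∏ k ∈ range n, cayley (y k))

theorem cayleyCoeff_succ_zero (y : ℕ → R) (r : ℕ) : cayleyCoeff y (r + 1) 0 = 0 := by
  simp [cayleyCoeff, coeff_one]

theorem constantCoeff_prod_cayley (y : ℕ → R) (n : ℕ) :
    constantCoeff (∏ k ∈ range n, cayley (y k)) = 1 := by
  rw [map_prod]
  exact prod_eq_one fun k _ => constantCoeff_cayley (y k)

/-- The increments in `n` of `cayleyCoeff y r n`; they are the coefficients of star sums in terms of
`starKernel`. -/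
noncomputable def cayleyIncr (y : ℕ → R) (r n : ℕ) : R :=
  cayleyCoeff y r (n + 1) - cayleyCoeff y r n

theorem sum_cayleyIncr (y : ℕ → R) (r n : ℕ) :
    ∑ k ∈ range n, cayleyIncr y (r + 1) k = cayleyCoeff y (r + 1) n := by
  simp only [cayleyIncr, sum_range_sub, cayleyCoeff_succ_zero, sub_zero]

theorem cayleyIncr_eq_mul (y : ℕ → R) (r n : ℕ) :
    cayleyIncr y (r + 1) n = y n * (cayleyCoeff y r (n + 1) + cayleyCoeff y r n) := by
  have h : (∏ k ∈ range (n + 1), cayley (y k)) * (1 - C (y n) * X) =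
      (∏ k ∈ range n, cayley (y k)) * (1 + C (y n) * X) := by
    rw [prod_range_succ, mul_assoc, cayley_mul_one_sub]
  have hcoeff := congrArg (coeff (r + 1)) h
  rw [mul_sub, mul_add, mul_one, mul_one, mul_left_comm, mul_left_comm (∏ k ∈ range n, _)] at hcoeff
  simp only [map_sub, map_add, coeff_C_mul, coeff_succ_mul_X] at hcoeff
  unfold cayleyIncr cayleyCoeff
  linear_combination hcoeff

theorem cayleyIncr_one (y : ℕ → R) (n : ℕ) : cayleyIncr y 1 n = 2 * y n := by
  have h0 (n : ℕ) : cayleyCoeff y 0 n = 1 := by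
    rw [cayleyCoeff, coeff_zero_eq_constantCoeff, constantCoeff_prod_cayley]
  rw [cayleyIncr_eq_mul, h0, h0]
  ring

theorem cayleyIncr_add_two (y : ℕ → R) (r n : ℕ) :
    cayleyIncr y (r + 2) n = y n * doubledSum (cayleyIncr y (r + 1)) n := by
  rw [cayleyIncr_eq_mul, doubledSum, sum_cayleyIncr, cayleyIncr]
  ring

end CommRing

section Topology

open Filter Topology

theorem tendsto_cayleyCoeff {K : Type*} [Field K] [CharZero K] [TopologicalSpace K]
    [IsTopologicalRing K] {y : ℕ → K} {F B : K⟦X⟧} (hF : HasLogDeriv F B)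
    (hF0 : constantCoeff F = 1)
    (hB : ∀ j, Tendsto (fun n => ∑ k ∈ range n, (y k ^ j - (-y k) ^ j)) atTop (𝓝 (coeff j B)))
    (r : ℕ) : Tendsto (cayleyCoeff y r) atTop (𝓝 (coeff r F)) := by
  refine HasLogDeriv.tendsto_coeff (fun n => .prod (range n) fun k _ => hasLogDeriv_cayley (y k))
    hF (constantCoeff_prod_cayley y) hF0 (fun j => ?_) r
  simpa only [map_sum, coeff_mk] using hB j

theorem summable_abs_cayleyIncr {y : ℕ → ℝ} (hy : Summable fun k => |y k|) {r : ℕ} {q : ℝ}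
    (hq : Tendsto (cayleyCoeff y r) atTop (𝓝 q)) : Summable fun k => |cayleyIncr y (r + 1) k| := by
  obtain ⟨M, hM⟩ := hq.abs.bddAbove_range
  have hM' (n : ℕ) : |cayleyCoeff y r n| ≤ M := hM ⟨n, rfl⟩
  refine .of_nonneg_of_le (fun k => abs_nonneg _) (fun k => ?_) (hy.mul_right (2 * M))
  rw [cayleyIncr_eq_mul, abs_mul]
  gcongr
  linarith [abs_add_le (cayleyCoeff y r (k + 1)) (cayleyCoeff y r k), hM' k, hM' (k + 1)]

theorem tsum_cayleyIncr {y : ℕ → ℝ} {r : ℕ} {q : ℝ}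
    (hs : Summable fun k => |cayleyIncr y (r + 1) k|)
    (hq : Tendsto (cayleyCoeff y (r + 1)) atTop (𝓝 q)) : ∑' k, cayleyIncr y (r + 1) k = q :=
  tendsto_nhds_unique hs.of_abs.hasSum.tendsto_sum_nat
    (hq.congr fun n => (sum_cayleyIncr y r n).symm)

end Topology

end Cayley

section Bernoulli

open PowerSeries

/-- The series `∑ B_{2n} / (2n)! X ^ n`, that is `x / 2 * coth (x / 2)` in the variable
`X = x ^ 2`. -/
noncomputable def evenBernoulliSeries : ℚ⟦X⟧ :=
  PowerSeries.mk fun n => bernoulli (2 * n) / (2 * n).factorial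

/-- The series `∑ (4 ^ (l + 1) - 1) B_{2l+2} / (2l+2)! X ^ l`, that is `tanh (x / 2) / (2 * x)` in
the variable `X = x ^ 2`. -/
noncomputable def tangentBernoulliSeries : ℚ⟦X⟧ :=
  PowerSeries.mk fun l => (4 ^ (l + 1) - 1) * (bernoulli (2 * l + 2) / (2 * l + 2).factorial)

theorem X_mul_tangentBernoulliSeries :
    X * tangentBernoulliSeries = rescale 4 evenBernoulliSeries - evenBernoulliSeries := by
  ext n
  cases n with
  | zero => simp only [map_sub, coeff_rescale, coeff_zero_X_mul, pow_zero, one_mul, sub_self]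
  | succ n =>
    simp only [coeff_succ_X_mul, tangentBernoulliSeries, evenBernoulliSeries, map_sub,
      coeff_rescale, coeff_mk, mul_add, mul_one]
    ring

theorem expand_two_evenBernoulliSeries :
    expand 2 two_ne_zero evenBernoulliSeries = bernoulliPowerSeries ℚ + C (1 / 2) * X := by
  ext n
  rcases Nat.even_or_odd' n with ⟨k, rfl | rfl⟩
  · rw [coeff_expand_mul]
    have : 2 * k ≠ 1 := by lia
    simp [evenBernoulliSeries, bernoulliPowerSeries, coeff_X, this]
  · rw [coeff_expand_of_not_dvd _ _ _ (by lia)]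
    rcases Nat.eq_zero_or_pos k with rfl | hk
    · norm_num [bernoulliPowerSeries]
    · have hodd : bernoulli (2 * k + 1) = 0 :=
        bernoulli_eq_zero_of_odd (odd_two_mul_add_one k) (by lia)
      simp [bernoulliPowerSeries, coeff_C, hk.ne', hodd]

theorem two_mul_C_half : (2 : ℚ⟦X⟧) * C (1 / 2) = 1 := by
  rw [← map_ofNat (C (R := ℚ)) 2, ← map_mul, mul_one_div_cancel two_ne_zero, map_one]

theorem expand_two_evenBernoulliSeries_mul :
    2 * expand 2 two_ne_zero evenBernoulliSeries * (exp ℚ - 1) = X * (exp ℚ + 1) := by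
  rw [expand_two_evenBernoulliSeries]
  linear_combination 2 * bernoulliPowerSeries_mul_exp_sub_one ℚ + X * (exp ℚ - 1) * two_mul_C_half

theorem expand_two_rescale_evenBernoulliSeries_mul :
    expand 2 two_ne_zero (rescale 4 evenBernoulliSeries) * (exp ℚ ^ 2 - 1) =
      X * (exp ℚ ^ 2 + 1) := by
  have hexp : rescale (2 : ℚ) (exp ℚ) = exp ℚ ^ 2 := by
    simpa using (exp_pow_eq_rescale_exp (A := ℚ) 2).symm
  have h := congrArg (rescale (2 : ℚ)) expand_two_evenBernoulliSeries_mul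
  rw [map_mul, map_mul, map_mul, ← expand_rescale, map_sub, map_add, map_one, hexp, rescale_X,
    map_ofNat, map_ofNat, mul_assoc, mul_assoc] at h
  rw [show (4 : ℚ) = 2 ^ 2 by norm_num]
  exact mul_left_cancel₀ (left_ne_zero_of_mul_eq_one two_mul_C_half) h

theorem exp_sub_one_ne_zero : exp ℚ - 1 ≠ 0 := by
  intro h
  have hB := bernoulliPowerSeries_mul_exp_sub_one ℚ
  rw [h, mul_zero] at hB
  exact X_ne_zero hB.symm

theorem exp_add_one_ne_zero : exp ℚ + 1 ≠ 0 := by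
  intro h
  simpa using congrArg constantCoeff h

/-- This is the duplication formula of `coth`. -/
theorem evenBernoulliSeries_duplication :
    4 * (rescale 4 evenBernoulliSeries - evenBernoulliSeries) * evenBernoulliSeries = X := by
  apply expand_injective 2 two_ne_zero
  have h := expand_two_evenBernoulliSeries_mul
  have hdup := expand_two_rescale_evenBernoulliSeries_mul
  simp only [map_mul, map_sub, map_ofNat, expand_X]
  set P := expand 2 two_ne_zero evenBernoulliSeries
  set E := exp ℚ
  apply mul_left_cancel₀ (mul_ne_zero (pow_ne_zero 2 exp_sub_one_ne_zero) exp_add_one_ne_zero)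
  linear_combination 4 * P * (E - 1) * hdup +
    (2 * X * (E ^ 2 + 1) - (E + 1) * (2 * P * (E - 1) + X * (E + 1))) * h

theorem evenBernoulliSeries_mul_tangentBernoulliSeries :
    evenBernoulliSeries * (4 * tangentBernoulliSeries) = 1 := by
  apply mul_left_cancel₀ (X_ne_zero (R := ℚ))
  linear_combination 4 * evenBernoulliSeries * X_mul_tangentBernoulliSeries +
    evenBernoulliSeries_duplication

/-- The logarithmic derivative of `evenBernoulliSeries`; its coefficients are
`(4 ^ n / 2 - 1) B_{2n} / (2n)!` for `n ≠ 0`. -/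
noncomputable def evenBernoulliLogDeriv : ℚ⟦X⟧ :=
  C (1 / 2) * (1 + rescale 4 evenBernoulliSeries) - evenBernoulliSeries

theorem coeff_evenBernoulliLogDeriv {n : ℕ} (hn : n ≠ 0) :
    coeff n evenBernoulliLogDeriv =
      (4 ^ n / 2 - 1) * (bernoulli (2 * n) / (2 * n).factorial) := by
  simp only [evenBernoulliLogDeriv, evenBernoulliSeries, map_sub, map_add, coeff_C_mul, coeff_one,
    if_neg hn, coeff_rescale, coeff_mk]
  ring

theorem eulerDeriv_exp : eulerDeriv ℚ (exp ℚ) = X * exp ℚ := by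
  rw [eulerDeriv_apply, derivative_exp]

theorem hasLogDeriv_evenBernoulliSeries :
    HasLogDeriv evenBernoulliSeries evenBernoulliLogDeriv := by
  have h := expand_two_evenBernoulliSeries_mul
  have hdup := expand_two_rescale_evenBernoulliSeries_mul
  have hderiv := congrArg (eulerDeriv ℚ) h
  have hX : eulerDeriv ℚ (X : ℚ⟦X⟧) = X := by rw [eulerDeriv_apply, derivative_X, mul_one]
  have htwo : eulerDeriv ℚ (2 : ℚ⟦X⟧) = 0 := Derivation.map_natCast _ 2
  simp only [Derivation.leibniz, map_sub, map_add, Derivation.map_one_eq_zero, eulerDeriv_exp, hX,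
    htwo, smul_eq_mul, eulerDeriv_expand] at hderiv
  apply expand_injective 2 two_ne_zero
  rw [evenBernoulliLogDeriv]
  simp only [map_mul, map_sub, map_add, map_one, expand_C]
  set P := expand 2 two_ne_zero evenBernoulliSeries
  set D := expand 2 two_ne_zero (rescale 4 evenBernoulliSeries)
  set E := exp ℚ
  apply mul_left_cancel₀ (mul_ne_zero (pow_ne_zero 2 (left_ne_zero_of_mul_eq_one two_mul_C_half))
    (pow_ne_zero 2 exp_sub_one_ne_zero))
  push_cast at hderiv
  linear_combination (E - 1) * hderiv - X * hdup +
    (2 * P * (E - 1) - (E - 1) * (1 + D) + X) * h -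
    2 * (E - 1) ^ 2 * P * (1 + D) * two_mul_C_half

theorem hasSum_alternating_zeta {K : ℕ} (hK : K ≠ 0) :
    HasSum (fun k : ℕ => (-1 : ℝ) ^ (k + 1) / ((k : ℝ) + 1) ^ (2 * K))
      ((-1) ^ K * Real.pi ^ (2 * K) * ((coeff K evenBernoulliLogDeriv : ℚ) : ℝ)) := by
  have h := hasSum_one_div_nat_pow_mul_cos hK (x := 2⁻¹) (by norm_num [Set.mem_Icc])
  have hcos (n : ℕ) : Real.cos (2 * Real.pi * n * 2⁻¹) = (-1) ^ n := by
    rw [← Real.cos_nat_mul_pi]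
    ring_nf
  have hval := bernoulliFun_eval_half (2 * K)
  rw [bernoulliFun] at hval
  simp only [hcos, hval, one_div_mul_eq_div] at h
  rw [← hasSum_nat_add_iff' 1] at h
  convert! h using 1
  · simp
  · have h4 : (2 : ℝ) ^ (2 * K) = 4 ^ K := by rw [pow_mul]; norm_num
    rw [coeff_evenBernoulliLogDeriv hK, sum_range_one, Nat.cast_zero, zero_pow (by lia), div_zero,
      sub_zero, mul_pow, h4]
    push_cast
    field_simp
    ring

end Bernoulli

section BernoulliProduct

open PowerSeries

/-- The root of unity `e^{π i / (m + 1)}`. -/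
noncomputable def halfRoot (m : ℕ) : ℂ := Complex.exp (Real.pi * Complex.I / (m + 1))

theorem halfRoot_pow_succ (m : ℕ) : halfRoot m ^ (m + 1) = -1 := by
  have hm : (m : ℂ) + 1 ≠ 0 := Nat.cast_add_one_ne_zero m
  rw [halfRoot, ← Complex.exp_nat_mul, ← Complex.exp_pi_mul_I]
  congr 1
  push_cast
  field_simp

theorem isPrimitiveRoot_halfRoot_sq (m : ℕ) : IsPrimitiveRoot (halfRoot m ^ 2) (m + 1) := by
  convert Complex.isPrimitiveRoot_exp (m + 1) m.succ_ne_zero using 1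
  rw [halfRoot, ← Complex.exp_nat_mul]
  congr 1
  push_cast
  ring

theorem mk_bernoulliConv (m : ℕ) :
    PowerSeries.mk (bernoulliConv m) =
      rescale (halfRoot m) (map (algebraMap ℚ ℂ) tangentBernoulliSeries) *
        map (algebraMap ℚ ℂ) evenBernoulliSeries := by
  ext n
  rw [coeff_mk, coeff_mul, bernoulliConv]
  simp only [coeff_rescale, coeff_map, tangentBernoulliSeries, evenBernoulliSeries, coeff_mk,
    eq_ratCast]
  rw [Finset.Nat.sum_antidiagonal_eq_sum_range_succ_mk]
  refine sum_congr rfl fun l _ => ?_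
  have hexp : Complex.exp (Real.pi * Complex.I * l / (m + 1)) = halfRoot m ^ l := by
    rw [halfRoot, ← Complex.exp_nat_mul]
    congr 1
    ring
  rw [hexp, Nat.mul_sub]
  push_cast
  ring

theorem four_mul_mk_bernoulliConv (m : ℕ) :
    4 * PowerSeries.mk (bernoulliConv m) =
      rescale (halfRoot m) (map (algebraMap ℚ ℂ) (4 * tangentBernoulliSeries)) *
        map (algebraMap ℚ ℂ) evenBernoulliSeries := by
  simp only [mk_bernoulliConv, map_mul, map_ofNat, mul_assoc]

theorem map_mul_map_tangentBernoulliSeries :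
    map (algebraMap ℚ ℂ) evenBernoulliSeries *
      map (algebraMap ℚ ℂ) (4 * tangentBernoulliSeries) = 1 := by
  rw [← map_mul, evenBernoulliSeries_mul_tangentBernoulliSeries, map_one]

theorem constantCoeff_four_mul_mk_bernoulliConv (m : ℕ) :
    constantCoeff (4 * PowerSeries.mk (bernoulliConv m)) = 1 := by
  rw [four_mul_mk_bernoulliConv, map_mul, constantCoeff_rescale, ← map_mul, mul_comm,
    map_mul_map_tangentBernoulliSeries, map_one]

theorem hasLogDeriv_four_mul_mk_bernoulliConv (m : ℕ) :
    HasLogDeriv (4 * PowerSeries.mk (bernoulliConv m))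
      (rescale (halfRoot m) (-map (algebraMap ℚ ℂ) evenBernoulliLogDeriv) +
        map (algebraMap ℚ ℂ) evenBernoulliLogDeriv) := by
  have h := hasLogDeriv_evenBernoulliSeries.map (algebraMap ℚ ℂ)
  rw [four_mul_mk_bernoulliConv]
  exact ((h.of_mul_eq_one map_mul_map_tangentBernoulliSeries).rescale (halfRoot m)).mul h

theorem compositionSum_eq_coeff (m N : ℕ) :
    compositionSum m N = coeff N (∏ k ∈ range (m + 1),
      rescale ((halfRoot m ^ 2) ^ k) (PowerSeries.mk (bernoulliConv m))) := by
  classical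
  rw [← Fin.prod_univ_eq_prod_range (fun k =>
    rescale ((halfRoot m ^ 2) ^ k) (PowerSeries.mk (bernoulliConv m))), coeff_prod, compositionSum]
  refine Finset.sum_nbij' (fun n => Finsupp.equivFunOnFinite.symm n) (fun n => ⇑n)
    (fun n hn => by simpa using hn) (fun n hn => by simpa using hn) (fun n _ => rfl)
    (fun n _ => Equiv.symm_apply_apply _ n) fun n _ => ?_
  simp only [Finsupp.equivFunOnFinite_symm_apply_apply, coeff_rescale, coeff_mk]
  rw [prod_mul_distrib]
  congr 1
  rw [mul_sum, Complex.exp_sum]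
  refine prod_congr rfl fun k _ => ?_
  rw [halfRoot, ← Complex.exp_nat_mul, ← Complex.exp_nat_mul, ← Complex.exp_nat_mul]
  congr 1
  push_cast
  ring

/-- The logarithmic derivative of `bernoulliProduct m`: twice the odd part of the multisection of
`evenBernoulliLogDeriv`. -/
noncomputable def bernoulliProductLogDeriv (m : ℕ) : ℚ⟦X⟧ :=
  multisection (m + 1) evenBernoulliLogDeriv -
    rescale (-1) (multisection (m + 1) evenBernoulliLogDeriv)

theorem coeff_bernoulliProductLogDeriv (m j : ℕ) : coeff j (bernoulliProductLogDeriv m) =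
    (1 - (-1) ^ j) * coeff ((m + 1) * j) evenBernoulliLogDeriv := by
  rw [bernoulliProductLogDeriv, map_sub, coeff_rescale, multisection, coeff_mk, one_sub_mul]

/-- The series `G` for which `G (X ^ (m + 1))` is the product over `k ≤ m` of
`φ (ω ^ (2k) X) / φ (ω ^ (2k+1) X)`, where `φ` is `evenBernoulliSeries` and `ω` is `halfRoot m`.
Defined through its logarithmic derivative, it visibly has rational coefficients. -/
noncomputable def bernoulliProduct (m : ℕ) : ℚ⟦X⟧ := ofLogDeriv (bernoulliProductLogDeriv m)

theorem constantCoeff_bernoulliProduct (m : ℕ) : constantCoeff (bernoulliProduct m) = 1 :=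
  constantCoeff_ofLogDeriv _

theorem hasLogDeriv_bernoulliProduct (m : ℕ) :
    HasLogDeriv (bernoulliProduct m) (bernoulliProductLogDeriv m) := by
  apply hasLogDeriv_ofLogDeriv
  rw [← coeff_zero_eq_constantCoeff_apply, coeff_bernoulliProductLogDeriv, pow_zero, sub_self,
    zero_mul]

theorem map_bernoulliProductLogDeriv (m : ℕ) :
    map (algebraMap ℚ ℂ) (bernoulliProductLogDeriv m) = multisection (m + 1)
      (rescale (halfRoot m) (-map (algebraMap ℚ ℂ) evenBernoulliLogDeriv) +
        map (algebraMap ℚ ℂ) evenBernoulliLogDeriv) := by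
  ext j
  simp only [multisection, coeff_mk, map_add, coeff_rescale, map_neg, coeff_map, pow_mul,
    halfRoot_pow_succ, coeff_bernoulliProductLogDeriv, map_mul, map_sub, map_one, map_pow]
  ring

theorem prod_rescale_mk_bernoulliConv (m : ℕ) :
    ∏ k ∈ range (m + 1), rescale ((halfRoot m ^ 2) ^ k) (4 * PowerSeries.mk (bernoulliConv m)) =
      expand (m + 1) m.succ_ne_zero (map (algebraMap ℚ ℂ) (bernoulliProduct m)) := by
  refine prod_rescale_primitiveRoot m.succ_ne_zero (isPrimitiveRoot_halfRoot_sq m)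
    (hasLogDeriv_four_mul_mk_bernoulliConv m) ?_ (constantCoeff_four_mul_mk_bernoulliConv m) ?_
  · rw [← map_bernoulliProductLogDeriv]
    exact (hasLogDeriv_bernoulliProduct m).map _
  · rw [← coeff_zero_eq_constantCoeff_apply, coeff_map, coeff_zero_eq_constantCoeff_apply,
      constantCoeff_bernoulliProduct, map_one]

theorem four_pow_mul_compositionSum (m r : ℕ) :
    4 ^ (m + 1) * compositionSum m ((m + 1) * r) =
      ((coeff r (bernoulliProduct m) : ℚ) : ℂ) := by
  have h4 (a : ℂ) : rescale a (4 : ℂ⟦X⟧) = C 4 := by rw [map_ofNat, map_ofNat]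
  rw [← eq_ratCast (algebraMap ℚ ℂ), ← coeff_map, ← coeff_expand_mul (m + 1) m.succ_ne_zero,
    ← prod_rescale_mk_bernoulliConv, compositionSum_eq_coeff, ← coeff_C_mul, map_pow]
  simp only [map_mul, h4, prod_mul_distrib, prod_const, card_range]

end BernoulliProduct

section BlockIndex

open PowerSeries

theorem index321_succ (m d : ℕ) : index321 m (d + 1) =
    List.replicate m 2 ++ [3] ++ List.replicate m 2 ++ [1] ++ index321 m d := by
  rw [index321, List.replicate_succ, List.flatten_cons, index321]

theorem hasStarCoeff_index321 (m d : ℕ) :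
    HasStarCoeff (index321 m (d + 1)) (cayleyIncr (altPow m) (2 * d + 2)) := by
  induction d with
  | zero =>
    rw [index321_succ]
    convert! HasStarCoeff.nil.block m m using 1
    ext k
    rw [cayleyIncr_add_two, funext (cayleyIncr_one (altPow m)), funext doubledSum_alternating]
    congr! 3
    ring
  | succ d ih =>
    rw [index321_succ]
    convert! ih.block m m using 1
    ext k
    rw [mul_add_one, cayleyIncr_add_two, funext (cayleyIncr_add_two (altPow m) (2 * d + 1))]

theorem hasStarCoeff_index321_append (m d : ℕ) :
    HasStarCoeff (index321 m d ++ List.replicate (m + 1) 2)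
      fun k => -cayleyIncr (altPow m) (2 * d + 1) k := by
  induction d with
  | zero =>
    have h := HasStarCoeff.nil.replicate_two (m + 1)
    rw [List.append_nil] at h
    rw [show index321 m 0 = [] from rfl, List.nil_append]
    convert h using 2 with k
    rw [mul_zero, cayleyIncr_one, altPow]
    ring
  | succ d ih =>
    rw [index321_succ, List.append_assoc]
    convert ih.block m m using 2 with k
    rw [mul_add_one, add_assoc, add_comm 2 1, ← add_assoc, cayleyIncr_add_two,
      funext (cayleyIncr_add_two (altPow m) (2 * d))]
    simp only [doubledSum_neg, mul_neg]

open Filter Topology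

theorem tendsto_sum_altPow_pow (m j : ℕ) :
    Tendsto (fun n => ∑ k ∈ range n, (altPow m k ^ j - (-altPow m k) ^ j)) atTop
      (𝓝 (((-1) ^ (m + 1) * Real.pi ^ (2 * (m + 1))) ^ j *
        ((coeff j (bernoulliProductLogDeriv m) : ℚ) : ℝ))) := by
  rw [coeff_bernoulliProductLogDeriv]
  rcases Nat.even_or_odd j with hj | hj
  · simp [hj.neg_pow]
  · have hK : (m + 1) * j ≠ 0 := mul_ne_zero m.succ_ne_zero hj.pos.ne'
    convert! ((hasSum_alternating_zeta hK).mul_left 2).tendsto_sum_nat using 2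
    · refine sum_congr rfl fun k _ => ?_
      rw [hj.neg_pow, altPow, div_pow, ← pow_mul, ← pow_mul, mul_comm (k + 1) j, pow_mul,
        hj.neg_one_pow, show (2 * m + 2) * j = 2 * ((m + 1) * j) by ring]
      ring
    · rw [hj.neg_one_pow, mul_pow, ← pow_mul, ← pow_mul, mul_assoc 2 (m + 1) j]
      push_cast
      ring

theorem tendsto_cayleyCoeff_altPow (m r : ℕ) :
    Tendsto (cayleyCoeff (altPow m) r) atTop
      (𝓝 (((-1) ^ (m + 1) * Real.pi ^ (2 * (m + 1))) ^ r *
        ((coeff r (bernoulliProduct m) : ℚ) : ℝ))) := by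
  have hF := ((hasLogDeriv_bernoulliProduct m).map (algebraMap ℚ ℝ)).rescale
    ((-1) ^ (m + 1) * Real.pi ^ (2 * (m + 1)))
  have h := tendsto_cayleyCoeff (y := altPow m) hF ?_ (fun j => ?_) r
  · simpa only [coeff_rescale, coeff_map, eq_ratCast] using h
  · rw [constantCoeff_rescale, ← coeff_zero_eq_constantCoeff_apply, coeff_map,
      coeff_zero_eq_constantCoeff_apply, constantCoeff_bernoulliProduct, map_one]
  · simpa only [coeff_rescale, coeff_map, eq_ratCast] using tendsto_sum_altPow_pow m j

theorem summable_abs_cayleyIncr_altPow (m r : ℕ) :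
    Summable fun k => |cayleyIncr (altPow m) (r + 1) k| :=
  summable_abs_cayleyIncr (summable_abs_altPow m) (tendsto_cayleyCoeff_altPow m r)

theorem tsum_cayleyIncr_altPow (m r : ℕ) :
    ∑' k, cayleyIncr (altPow m) (r + 1) k =
      ((-1) ^ (m + 1) * Real.pi ^ (2 * (m + 1))) ^ (r + 1) *
        ((coeff (r + 1) (bernoulliProduct m) : ℚ) : ℝ) :=
  tsum_cayleyIncr (summable_abs_cayleyIncr_altPow m r) (tendsto_cayleyCoeff_altPow m (r + 1))

theorem hasSum_mzvTerm_index321 (m : ℕ) {d : ℕ} (hd : 1 ≤ d) :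
    HasSum (fun k : StarIndex (index321 m d).length => mzvTerm (index321 m d) k.1)
      (Real.pi ^ (4 * (m + 1) * d) * ((coeff (2 * d) (bernoulliProduct m) : ℚ) : ℝ)) := by
  obtain ⟨d, rfl⟩ := Nat.exists_eq_add_of_le' hd
  convert (hasStarCoeff_index321 m d).hasSum_mzvTerm (summable_abs_cayleyIncr_altPow m _) using 1
  rw [tsum_cayleyIncr_altPow, show 2 * d + 1 + 1 = 2 * (d + 1) by ring, mul_pow,
    pow_right_comm (-1 : ℝ), (even_two_mul _).neg_one_pow, one_pow, one_mul, ← pow_mul]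
  ring_nf

theorem hasSum_mzvTerm_index321_append (m d : ℕ) :
    HasSum (fun k : StarIndex (index321 m d ++ List.replicate (m + 1) 2).length =>
        mzvTerm (index321 m d ++ List.replicate (m + 1) 2) k.1)
      ((-1) ^ m * Real.pi ^ (2 * (m + 1) * (2 * d + 1)) *
        ((coeff (2 * d + 1) (bernoulliProduct m) : ℚ) : ℝ)) := by
  convert (hasStarCoeff_index321_append m d).hasSum_mzvTerm
    (by simpa only [abs_neg] using summable_abs_cayleyIncr_altPow m (2 * d)) using 1
  rw [tsum_neg, tsum_cayleyIncr_altPow, mul_pow, pow_right_comm (-1 : ℝ),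
    (odd_two_mul_add_one d).neg_one_pow, ← pow_mul, pow_succ]
  ring

end BlockIndex

theorem theorem3 (m d : ℕ) (hd : 1 ≤ d) :
    (ZetaStarConverges (index321 m d) ∧
      (zetaStar (index321 m d) : ℂ) =
        4 ^ (m + 1) * (Real.pi : ℂ) ^ (4 * d * (m + 1)) *
          compositionSum m (2 * (m + 1) * d)) ∧
    (ZetaStarConverges (index321 m d ++ List.replicate (m + 1) 2) ∧
      (zetaStar (index321 m d ++ List.replicate (m + 1) 2) : ℂ) =
        (-1) ^ m * 4 ^ (m + 1) * (Real.pi : ℂ) ^ ((4 * d + 2) * (m + 1)) *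
          compositionSum m ((m + 1) * (2 * d + 1))) ∧
    (∃ q : ℚ, zetaStar (index321 m d) = q * Real.pi ^ (4 * (m + 1) * d)) ∧
    (∃ q : ℚ, zetaStar (index321 m d ++ List.replicate (m + 1) 2) =
      q * Real.pi ^ (2 * (m + 1) * (2 * d + 1))) := by
  have h1 := hasSum_mzvTerm_index321 m hd
  have h2 := hasSum_mzvTerm_index321_append m d
  have hG1 := four_pow_mul_compositionSum m (2 * d)
  have hG2 := four_pow_mul_compositionSum m (2 * d + 1)
  rw [← mul_assoc, mul_comm (m + 1) 2] at hG1
  refine ⟨⟨h1.summable, ?_⟩, ⟨h2.summable, ?_⟩, ⟨_, h1.tsum_eq.trans (mul_comm _ _)⟩,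
    ⟨(-1) ^ m * PowerSeries.coeff (2 * d + 1) (bernoulliProduct m), ?_⟩⟩
  · rw [zetaStar, h1.tsum_eq]
    push_cast
    linear_combination -(Real.pi : ℂ) ^ (4 * d * (m + 1)) * hG1
  · rw [zetaStar, h2.tsum_eq]
    push_cast
    linear_combination -(-1) ^ m * (Real.pi : ℂ) ^ ((4 * d + 2) * (m + 1)) * hG2
  · rw [zetaStar, h2.tsum_eq]
    push_cast
    ring
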